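/- Let $\mathcal H$ be a real separable Hilbert space, $J=\begin{bmatrix}0&I\\-I&0\end{bmatrix}$ on the Hilbert space direct sum $\mathcal H\oplus\mathcal H$, and let $T$ be a bounded positive (self-adjoint, positive semidefinite) invertible operator on $\mathcal H\oplus\mathcal H$ such that $T-\alpha I$ is compact for some $\alpha\in\mathbb R\setminus\{0\}$. A Williamson normal form of $T$ is a bounded positive invertible operator $D$ on $\mathcal H$ such that $T=M^{T}\begin{bmatrix}D&0\\0&D\end{bmatrix}M$ for some bounded invertible operator $M$ on $\mathcal H\oplus\mathcal H$ with $M^TJM=J$. For a bounded self-adjoint operator $A$ and $j\ge 1$ let $\lambda_j^\downarrow(A)$ be the supremum of all real $t$ such that at least $j$ eigenvalues of $A$, counted with multiplicity, are $\ge t$, and let $\lambda_j^\uparrow(A)$ be the infimum of all real $t$ such that at least $j$ eigenvalues of $A$, counted with multiplicity, are $\le t$. (These are the $j$-th largest and the $j$-th smallest eigenvalue of $A$ whenever the decreasing, respectively increasing, enumeration of the eigenvalues has a $j$-th term; for $T$ and $D$ as here and $j$ as below, the only other possible value is the point at which the eigenvalues accumulate.) The symplectic eigenvalues of $T$ are the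 eigenvalues of a Williamson normal form $D$ of $T$, and $d_j^\downarrow(T)=\lambda_j^\downarrow(D)$, $d_j^\uparrow(T)=\lambda_j^\uparrow(D)$. Then $T$ has a Williamson normal form, and for every Williamson normal form $D$ of $T$ and every integer $j\ge1$ (with $j\le\dim\mathcal H$ if $\mathcal H$ is finite-dimensional), 1. $d_j^\downarrow(T)\le\lambda_j^\downarrow(T)$, 2. $\lambda_j^\uparrow(T)\le d_j^\uparrow(T)$. -/

import Mathlib

open scoped InnerProductSpace

noncomputable section

/-- The Hilbert space direct sum `H ⊕ H`, with `‖(x, y)‖² = ‖x‖² + ‖y‖²`. -/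
abbrev HilbertSum (H : Type*) [NormedAddCommGroup H] [InnerProductSpace ℝ H] : Type _ :=
  WithLp 2 (H × H)

section
variable {H : Type*} [NormedAddCommGroup H] [InnerProductSpace ℝ H]

/-- The block operator `J = [[0, I], [-I, 0]]` on `H ⊕ H`, i.e. `J (x, y) = (y, -x)`. -/
def sympJ : HilbertSum H →L[ℝ] HilbertSum H :=
  (WithLp.prodContinuousLinearEquiv 2 ℝ H H).symm.toContinuousLinearMap ∘L
    ((ContinuousLinearMap.snd ℝ H H).prod (-ContinuousLinearMap.fst ℝ H H)) ∘L
    (WithLp.prodContinuousLinearEquiv 2 ℝ H H).toContinuousLinearMap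

/-- The block diagonal operator `[[D, 0], [0, D]]` on `H ⊕ H`. -/
def doubled (D : H →L[ℝ] H) : HilbertSum H →L[ℝ] HilbertSum H :=
  (WithLp.prodContinuousLinearEquiv 2 ℝ H H).symm.toContinuousLinearMap ∘L
    (D.prodMap D) ∘L
    (WithLp.prodContinuousLinearEquiv 2 ℝ H H).toContinuousLinearMap

/-- `M` is a symplectic transformation: a bounded invertible operator with `Mᵀ J M = J`. -/
def IsSymplecticTransformation [CompleteSpace H] (M : HilbertSum H →L[ℝ] HilbertSum H) : Prop :=
  IsUnit M ∧ ContinuousLinearMap.adjoint M ∘L sympJ ∘L M = sympJ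

/-- `D` is a Williamson normal form of `T`: `D` is a positive invertible operator on `H` and
`T = Mᵀ [[D, 0], [0, D]] M` for some symplectic transformation `M`.
The symplectic eigenvalues of `T` (with their multiplicities) are the eigenvalues of `D`. -/
def IsWilliamsonForm [CompleteSpace H] (T : HilbertSum H →L[ℝ] HilbertSum H)
    (D : H →L[ℝ] H) : Prop :=
  D.IsPositive ∧ IsUnit D ∧
    ∃ M : HilbertSum H →L[ℝ] HilbertSum H, IsSymplecticTransformation M ∧
      T = ContinuousLinearMap.adjoint M ∘L doubled D ∘L M

end

section
variable {E : Type*} [NormedAddCommGroup E] [InnerProductSpace ℝ E]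

/-- The number of eigenvalues of `A` that lie in `s`, counted with multiplicity: the dimension of
the (automatically direct) sum of the eigenspaces `ker (A - μ)`, `μ ∈ s`. -/
def eigenvalueCount (A : E →L[ℝ] E) (s : Set ℝ) : Cardinal :=
  Module.rank ℝ ↥(⨆ μ ∈ s, Module.End.eigenspace (A : E →ₗ[ℝ] E) μ)

/-- `λ_j^↓(A)`: the `j`-th largest eigenvalue of `A`, counted with multiplicity, for `j ≥ 1`.
It is the supremum of the `t` such that at least `j` eigenvalues are `≥ t`. Where the decreasing
enumeration of the eigenvalues has a `j`-th term, this supremum is attained and is that term.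
If `A` is self-adjoint on an infinite-dimensional space and `A - α I` is compact, then the only
other case is that fewer than `j` eigenvalues are `≥ α`; the supremum is then `α`, to which the
eigenvalues converge from below. -/
def eigenvalueDecr (A : E →L[ℝ] E) (j : ℕ) : ℝ :=
  sSup {t : ℝ | (j : Cardinal) ≤ eigenvalueCount A (Set.Ici t)}

/-- `λ_j^↑(A)`: the `j`-th smallest eigenvalue of `A`, counted with multiplicity, for `j ≥ 1`:
the infimum of the `t` such that at least `j` eigenvalues are `≤ t`. -/
def eigenvalueIncr (A : E →L[ℝ] E) (j : ℕ) : ℝ :=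
  sInf {t : ℝ | (j : Cardinal) ≤ eigenvalueCount A (Set.Iic t)}

end

end

/-!
The bounds rest on a dimension count that replaces the minimax principle. Let `T = Mᵀ (D ⊕ D) M`
with `M` symplectic, so that also `M J Mᵀ = J`. For `u` in `H ⊕ H` put `z = M⁻¹ u` and
`y = T z = Mᵀ (D ⊕ D) u`. Then `⟪T z, z⟫ = ⟪(D ⊕ D) u, u⟫`, and, since `J` is an isometry commuting
with `D ⊕ D`, `⟪T J y, J y⟫ = ⟪(D ⊕ D) w, w⟫` for `w = (D ⊕ D) u`. Suppose that `D` has at least `j`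
eigenvalues `≥ t`, with spectral subspace `W`, but `T` has fewer than `j` eigenvalues `≥ s`, with
spectral subspace `V`. As `dim (W ⊕ W) ≥ 2 j > 2 dim V`, some `u ≠ 0` in `W ⊕ W` makes both `y` and
`J y` orthogonal to `V` (`exists_mem_doubled_orthogonal`), and then
`t² ⟪(D ⊕ D) u, u⟫ ≤ ⟪T J y, J y⟫ ≤ s ‖J y‖² = s ‖T z‖² ≤ s² ⟪T z, z⟫ = s² ⟪(D ⊕ D) u, u⟫`,
so `t ≤ s`. The increasing enumeration is treated by reversing all inequalities. The estimates are
read off in Hilbert bases of eigenvectors. For `T` such a basis comes from the spectral theorem for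
compact operators. For `D` one uses that `J T` is similar to `J (D ⊕ D)`: taking squares, `D² - α²`
is compact, and the eigenvectors of `D²` are eigenvectors of the positive operator `D`.

For the existence of `D`, let `R = T ^ (1 / 2)` and `B = R J R`, which is skew-adjoint and invertible,
with `-B² - α²` compact. A maximal orthonormal set `S` of eigenvectors `v` of `-B²` with
`⟪v, B w⟫ = 0` for `v, w ∈ S` (`exists_maximal_isotropic_eigenvectors`) gives the orthonormal basis
`v, ‖B v‖⁻¹ B v` of `H ⊕ H`, on which `B` acts by `2 × 2` blocks
(`exists_hilbertBasis_of_skew`). Since `H` is separable, `S` indexes a Hilbert basis of `H`, and there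
is an orthogonal `Q` with `Q B Q⁻¹ = J (D ⊕ D)`, where `D` is diagonal with entries `‖B v‖`. The
operator `M = (D ⊕ D) ^ (-1 / 2) Q R` is symplectic and brings `T` to its normal form
(`exists_isWilliamsonForm`).
-/

open Module.End (eigenspace)

/-! ### Operators diagonal in a Hilbert basis -/

section
variable {E : Type*} [NormedAddCommGroup E] [InnerProductSpace ℝ E]

theorem HilbertBasis.clm_ext {ι F : Type*} [NormedAddCommGroup F] [NormedSpace ℝ F]
    (b : HilbertBasis ι ℝ E) {A B : E →L[ℝ] F} (h : ∀ i, A (b i) = B (b i)) : A = B := by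
  refine ContinuousLinearMap.ext_on (s := Set.range b) ?_ ?_
  · have := b.dense_span
    rw [Submodule.dense_iff_topologicalClosure_eq_top]
    exact this
  · rintro _ ⟨i, rfl⟩
    exact h i

/-- A bounded family of real numbers is the diagonal of a bounded operator. -/
theorem HilbertBasis.exists_diagonal {ι : Type*} (b : HilbertBasis ι ℝ E) (c : ι → ℝ) {C : ℝ}
    (hc : ∀ i, |c i| ≤ C) : ∃ A : E →L[ℝ] E, ∀ i, A (b i) = c i • b i := by
  classical
  have hle (f : lp (fun _ : ι => ℝ) 2) (i : ι) :
      ‖c i * f i‖ ≤ ‖((C • f : lp (fun _ : ι => ℝ) 2) i)‖ := by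
    rw [lp.coeFn_smul, Pi.smul_apply, smul_eq_mul, norm_mul, norm_mul]
    gcongr
    exact (hc i).trans (le_abs_self C)
  have hmem (f : lp (fun _ : ι => ℝ) 2) : Memℓp (fun i => c i * f i) 2 :=
    Memℓp.mono' (lp.memℓp (C • f)) (hle f)
  let m : lp (fun _ : ι => ℝ) 2 →ₗ[ℝ] lp (fun _ : ι => ℝ) 2 :=
    { toFun := fun f => ⟨fun i => c i * f i, hmem f⟩
      map_add' := fun f g => by ext i; exact mul_add _ _ _
      map_smul' := fun r f => by ext i; exact mul_left_comm _ _ _ }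
  let M : lp (fun _ : ι => ℝ) 2 →L[ℝ] lp (fun _ : ι => ℝ) 2 :=
    m.mkContinuous ‖C‖ fun f => by
      rw [← norm_smul]
      exact lp.norm_mono (by norm_num) (hle f)
  refine ⟨(b.repr.symm.toContinuousLinearEquiv : _ →L[ℝ] E) ∘L M ∘L
    (b.repr.toContinuousLinearEquiv : E →L[ℝ] _), fun i => ?_⟩
  apply b.repr.injective
  ext k
  simp [M, m, b.repr_self, lp.single_apply, Pi.single_apply]
  grind

/-- `A` is diagonal in the Hilbert basis `b`, with eigenvalue `c i` at `b i`. -/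
def IsDiagonalIn {ι : Type*} (A : E →L[ℝ] E) (b : HilbertBasis ι ℝ E) (c : ι → ℝ) : Prop :=
  ∀ i, A (b i) = c i • b i

namespace IsDiagonalIn

variable {ι : Type*} {A A' : E →L[ℝ] E} {b : HilbertBasis ι ℝ E} {c c' : ι → ℝ}

theorem inner_apply (h : IsDiagonalIn A b c) (x : E) (i : ι) :
    ⟪b i, A x⟫_ℝ = c i * ⟪b i, x⟫_ℝ := by
  have : innerSL ℝ (b i) ∘L A = c i • innerSL ℝ (b i) := by
    refine b.clm_ext fun k => ?_
    by_cases hik : i = k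
    · subst hik; simp [h i]
    · simp [h k, b.orthonormal.2 hik]
  simpa using congrArg (fun f : E →L[ℝ] ℝ => f x) this

theorem isSymmetric (h : IsDiagonalIn A b c) : (A : E →ₗ[ℝ] E).IsSymmetric := by
  intro x y
  refine (b.hasSum_inner_mul_inner (A x) y).unique ?_
  have hterm : ∀ i, ⟪A x, b i⟫_ℝ * ⟪b i, y⟫_ℝ = ⟪x, b i⟫_ℝ * ⟪b i, A y⟫_ℝ := fun i => by
    rw [real_inner_comm, h.inner_apply, h.inner_apply, real_inner_comm x]
    ring
  simpa only [hterm] using! b.hasSum_inner_mul_inner x (A y)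

theorem mul (h : IsDiagonalIn A b c) (h' : IsDiagonalIn A' b c') :
    IsDiagonalIn (A * A') b (c * c') := fun i => by
  simp [h' i, h i, smul_smul, mul_comm]

theorem eq (h : IsDiagonalIn A b c) (h' : IsDiagonalIn A' b c) : A = A' :=
  b.clm_ext fun i => by rw [h i, h' i]

theorem one : IsDiagonalIn (1 : E →L[ℝ] E) b 1 := fun i => by simp

theorem hasSum_inner (h : IsDiagonalIn A b c) (x : E) :
    HasSum (fun i => c i * ⟪b i, x⟫_ℝ ^ 2) ⟪A x, x⟫_ℝ := by
  have hterm : ∀ i, ⟪A x, b i⟫_ℝ * ⟪b i, x⟫_ℝ = c i * ⟪b i, x⟫_ℝ ^ 2 := fun i => by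
    rw [real_inner_comm, h.inner_apply]
    ring
  simpa only [hterm] using! b.hasSum_inner_mul_inner (A x) x

theorem hasSum_norm_sq (h : IsDiagonalIn A b c) (x : E) :
    HasSum (fun i => c i ^ 2 * ⟪b i, x⟫_ℝ ^ 2) (‖A x‖ ^ 2) := by
  rw [← real_inner_self_eq_norm_sq]
  have hterm : ∀ i, ⟪A x, b i⟫_ℝ * ⟪b i, A x⟫_ℝ = c i ^ 2 * ⟪b i, x⟫_ℝ ^ 2 := fun i => by
    rw [real_inner_comm, h.inner_apply]
    ring
  simpa only [hterm] using! b.hasSum_inner_mul_inner (A x) (A x)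

theorem isPositive (h : IsDiagonalIn A b c) (hc : ∀ i, 0 ≤ c i) : A.IsPositive :=
  (ContinuousLinearMap.isPositive_iff A).2
    ⟨h.isSymmetric, fun x => (h.hasSum_inner x).nonneg fun i => mul_nonneg (hc i) (sq_nonneg _)⟩

theorem abs_le_norm (h : IsDiagonalIn A b c) (i : ι) : |c i| ≤ ‖A‖ := by
  have := A.le_opNorm (b i)
  rw [h i, norm_smul, b.orthonormal.1 i] at this
  simpa using this

theorem nonneg (h : IsDiagonalIn A b c) (hA : A.IsPositive) (i : ι) : 0 ≤ c i := by
  have := hA.inner_nonneg_left (b i)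
  rwa [h i, inner_smul_left, real_inner_self_eq_norm_sq, b.orthonormal.1 i, RCLike.conj_to_real,
    one_pow, mul_one] at this

theorem exists_pos_le_abs (h : IsDiagonalIn A b c) (hA : IsUnit A) :
    ∃ ε > 0, ∀ i, ε ≤ |c i| := by
  obtain ⟨u, rfl⟩ := hA
  refine ⟨(‖((u⁻¹ : (E →L[ℝ] E)ˣ) : E →L[ℝ] E)‖ + 1)⁻¹, by positivity, fun i => ?_⟩
  rw [inv_le_iff_one_le_mul₀ (by positivity)]
  have h1 : (((u⁻¹ : (E →L[ℝ] E)ˣ) : E →L[ℝ] E)) ((u : E →L[ℝ] E) (b i)) = b i := by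
    rw [← mul_apply_eq_comp, Units.inv_mul]; rfl
  have h2 := congrArg norm h1
  rw [h i, map_smul, norm_smul, b.orthonormal.1 i] at h2
  have h3 := (((u⁻¹ : (E →L[ℝ] E)ˣ) : E →L[ℝ] E)).le_opNorm (b i)
  rw [b.orthonormal.1 i, mul_one] at h3
  rw [← h2, ← Real.norm_eq_abs]
  exact mul_le_mul_of_nonneg_left (by linarith) (norm_nonneg _)

/-- The eigenvalues of a positive invertible operator are bounded away from zero. -/
theorem exists_pos_le (h : IsDiagonalIn A b c) (hA : A.IsPositive) (hu : IsUnit A) :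
    ∃ ε > 0, ∀ i, ε ≤ c i := by
  obtain ⟨ε, hε, hle⟩ := h.exists_pos_le_abs hu
  exact ⟨ε, hε, fun i => (hle i).trans_eq (abs_of_nonneg (h.nonneg hA i))⟩

end IsDiagonalIn

/-! ### Bases of eigenvectors -/

/-- The spectral theorem for a compact perturbation of a scalar operator: its eigenvectors span a
dense subspace. -/
theorem orthogonal_iSup_eigenspace_eq_bot [CompleteSpace E] {A : E →L[ℝ] E} {α : ℝ}
    (hA : (A : E →ₗ[ℝ] E).IsSymmetric)
    (hcomp : IsCompactOperator (A - α • ContinuousLinearMap.id ℝ E)) :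
    (⨆ μ, eigenspace (A : E →ₗ[ℝ] E) μ)ᗮ = ⊥ := by
  have hsym : ((A - α • ContinuousLinearMap.id ℝ E : E →L[ℝ] E) : E →ₗ[ℝ] E).IsSymmetric := by
    intro x y
    have := hA x y
    simp only [ContinuousLinearMap.coe_coe] at this
    simp [inner_sub_left, inner_sub_right, inner_smul_left, inner_smul_right, this]
  rw [eq_bot_iff,
    ← ContinuousLinearMap.orthogonalComplement_iSup_eigenspaces_eq_bot hcomp hsym]
  refine Submodule.orthogonal_le (iSup_le fun μ => ?_)
  refine le_trans ?_ (le_iSup _ (μ + α))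
  intro x hx
  rw [Module.End.mem_eigenspace_iff] at hx ⊢
  simp only [ContinuousLinearMap.coe_coe, sub_apply,
    smul_apply, ContinuousLinearMap.id_apply] at hx ⊢
  rw [add_smul, ← hx]
  abel

/-- Let `C` be symmetric with densely spanning eigenvectors and let `B` be skew and commute with `C`.
Then there is an orthonormal set `S` of eigenvectors of `C` that is isotropic for the alternating form
`⟪v, B w⟫` and so large that `S ∪ B S` spans a dense subspace. The proof takes `S` maximal: a vector
orthogonal to `S ∪ B S` would yield, after projecting a suitable eigenvector of `C`, a further element
of `S`. For `B = 0` this gives a Hilbert basis of eigenvectors. -/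
theorem exists_maximal_isotropic_eigenvectors [CompleteSpace E] {C B : E →L[ℝ] E}
    (hC : (C : E →ₗ[ℝ] E).IsSymmetric) (hdense : (⨆ μ, eigenspace (C : E →ₗ[ℝ] E) μ)ᗮ = ⊥)
    (hB : ∀ x y, ⟪B x, y⟫_ℝ = -⟪x, B y⟫_ℝ) (hBC : ∀ x, C (B x) = B (C x)) :
    ∃ S : Set E, Orthonormal ℝ ((↑) : S → E) ∧ (∀ v ∈ S, ∃ μ : ℝ, C v = μ • v) ∧
      (∀ v ∈ S, ∀ w ∈ S, ⟪v, B w⟫_ℝ = 0) ∧ (Submodule.span ℝ (S ∪ B '' S))ᗮ = ⊥ := by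
  let P : Set (Set E) := {S | (∀ v ∈ S, ‖v‖ = 1 ∧ ∃ μ : ℝ, C v = μ • v) ∧
    ∀ v ∈ S, ∀ w ∈ S, (v ≠ w → ⟪v, w⟫_ℝ = 0) ∧ ⟪v, B w⟫_ℝ = 0}
  obtain ⟨S, hS⟩ : ∃ S, Maximal (· ∈ P) S := by
    refine zorn_subset P fun c hcP hchain => ⟨⋃₀ c, ⟨?_, ?_⟩, fun s => Set.subset_sUnion_of_mem⟩
    · rintro v ⟨s, hs, hv⟩
      exact (hcP hs).1 v hv
    · rintro v ⟨s, hs, hv⟩ w ⟨t, ht, hw⟩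
      rcases hchain.total hs ht with hst | hst
      · exact (hcP ht).2 v (hst hv) w hw
      · exact (hcP hs).2 v hv w (hst hw)
  obtain ⟨hSev, hSpair⟩ := hS.prop
  refine ⟨S, ⟨fun v => (hSev v v.2).1, fun v w hvw => (hSpair v v.2 w w.2).1
    (by simpa [Subtype.ext_iff] using hvw)⟩, fun v hv => (hSev v hv).2,
    fun v hv w hw => (hSpair v hv w hw).2, ?_⟩
  by_contra hne
  set L := Submodule.span ℝ (S ∪ B '' S) with hL
  obtain ⟨v, hvL, hv0⟩ := Submodule.exists_mem_ne_zero_of_ne_bot hne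
  -- an eigenvector `x` of `C` not orthogonal to `v ∈ Lᗮ`; as `Lᗮ` and `Lᗮᗮ` are invariant under
  -- `C`, its projection `p` to `Lᗮ` is again an eigenvector
  obtain ⟨μ, x, hx, hxv⟩ : ∃ μ : ℝ, ∃ x, C x = μ • x ∧ ⟪x, v⟫_ℝ ≠ 0 := by
    by_contra! hcon
    refine hv0 ?_
    have : v ∈ (⨆ μ, eigenspace (C : E →ₗ[ℝ] E) μ)ᗮ := by
      rw [← Submodule.iInf_orthogonal]
      simp only [Submodule.mem_iInf, Submodule.mem_orthogonal]
      exact fun μ u hu => hcon μ u (Module.End.mem_eigenspace_iff.1 hu)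
    simpa [hdense] using this
  have hCL : ∀ y ∈ L, C y ∈ L := by
    intro y hy
    induction hy using Submodule.span_induction with
    | mem y hy =>
      rcases hy with hy | ⟨y, hy, rfl⟩
      · obtain ⟨ν, hν⟩ := (hSev y hy).2
        rw [hν]
        exact L.smul_mem _ (Submodule.subset_span (Or.inl hy))
      · obtain ⟨ν, hν⟩ := (hSev y hy).2
        rw [hBC, hν, map_smul]
        exact L.smul_mem _ (Submodule.subset_span (Or.inr ⟨y, hy, rfl⟩))
    | zero => simp
    | add y z _ _ hy hz => rw [map_add]; exact L.add_mem hy hz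
    | smul a y _ hy => rw [map_smul]; exact L.smul_mem _ hy
  have horth : ∀ U : Submodule ℝ E, (∀ y ∈ U, C y ∈ U) → ∀ y ∈ Uᗮ, C y ∈ Uᗮ := by
    intro U hU y hy
    rw [Submodule.mem_orthogonal] at hy ⊢
    intro u hu
    exact (hC u y).symm.trans (hy _ (hU u hu))
  set p := Lᗮ.starProjection x with hp
  have hpL : p ∈ Lᗮ := by simp [hp]
  have hqL : x - p ∈ Lᗮᗮ := by simp [hp]
  have hCp : C p = μ • p := by
    have h1 : C p - μ • p ∈ Lᗮ :=
      Submodule.sub_mem _ (horth L hCL p hpL) (Submodule.smul_mem _ _ hpL)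
    have h2 : C p - μ • p ∈ Lᗮᗮ := by
      have := Submodule.sub_mem _ (Submodule.smul_mem _ μ hqL)
        (horth Lᗮ (horth L hCL) _ hqL)
      convert this using 1
      rw [map_sub, hx, smul_sub]
      abel
    have := (Submodule.orthogonal_disjoint Lᗮ).le_bot ⟨h1, h2⟩
    exact sub_eq_zero.1 (by simpa using this)
  have hp0 : p ≠ 0 := by
    intro h0
    rw [h0, sub_zero] at hqL
    exact hxv ((Submodule.mem_orthogonal' _ _).1 hqL v hvL)
  have hpS : ∀ w ∈ S, ⟪w, p⟫_ℝ = 0 ∧ ⟪B w, p⟫_ℝ = 0 := fun w hw =>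
    ⟨(Submodule.mem_orthogonal _ _).1 hpL w (Submodule.subset_span (Or.inl hw)),
      (Submodule.mem_orthogonal _ _).1 hpL _ (Submodule.subset_span (Or.inr ⟨w, hw, rfl⟩))⟩
  set q := ‖p‖⁻¹ • p with hq
  have hq1 : ‖q‖ = 1 := norm_smul_inv_norm hp0
  have hqS : ∀ w ∈ S, ⟪w, q⟫_ℝ = 0 ∧ ⟪B w, q⟫_ℝ = 0 := fun w hw => by
    simp [hq, inner_smul_right, hpS w hw]
  -- `q` can be added to `S`; that `⟪q, B q⟫ = 0` is automatic because `B` is skew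
  have hmem : insert q S ∈ P := by
    refine ⟨?_, ?_⟩
    · rintro w (rfl | hw)
      · exact ⟨hq1, μ, by rw [hq, map_smul, hCp, smul_comm]⟩
      · exact hSev w hw
    · rintro w (rfl | hw) z (rfl | hz)
      · refine ⟨fun h => absurd rfl h, ?_⟩
        have := hB q q
        rw [real_inner_comm] at this
        linarith
      · exact ⟨fun _ => by rw [real_inner_comm]; exact (hqS z hz).1,
          by rw [real_inner_comm]; exact (hqS z hz).2⟩
      · refine ⟨fun _ => (hqS w hw).1, ?_⟩
        have := hB w q
        rw [(hqS w hw).2] at this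
        linarith
      · exact hSpair w hw z hz
  have hqin : q ∈ S := hS.le_of_ge hmem (Set.subset_insert q S) (Set.mem_insert q S)
  have := (hqS q hqin).1
  rw [real_inner_self_eq_norm_sq, hq1] at this
  norm_num at this

theorem exists_isDiagonalIn [CompleteSpace E] {A : E →L[ℝ] E}
    (hA : (A : E →ₗ[ℝ] E).IsSymmetric) (hdense : (⨆ μ, eigenspace (A : E →ₗ[ℝ] E) μ)ᗮ = ⊥) :
    ∃ (S : Set E) (b : HilbertBasis S ℝ E) (c : S → ℝ), IsDiagonalIn A b c := by
  obtain ⟨S, hon, hev, -, hbot⟩ := exists_maximal_isotropic_eigenvectors (B := 0) hA hdense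
    (by simp) (by simp)
  choose! c hc using hev
  have hspan : (Submodule.span ℝ (Set.range ((↑) : S → E)))ᗮ = ⊥ := by
    rw [Subtype.range_coe, eq_bot_iff, ← hbot]
    refine Submodule.orthogonal_le (Submodule.span_le.2 ?_)
    rintro x (hx | ⟨y, -, rfl⟩)
    · exact Submodule.subset_span hx
    · simp
  refine ⟨S, HilbertBasis.mkOfOrthogonalEqBot hon hspan, fun v => c v, fun v => ?_⟩
  rw [HilbertBasis.coe_mkOfOrthogonalEqBot]
  exact hc v v.2

end

/-! ### Counting eigenvalues -/

section
variable {E : Type*} [NormedAddCommGroup E] [InnerProductSpace ℝ E]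

theorem exists_eigenvector_of_le_eigenvalueCount {A : E →L[ℝ] E} {s : Set ℝ} {j : ℕ} (hj : 1 ≤ j)
    (h : (j : Cardinal) ≤ eigenvalueCount A s) : ∃ μ ∈ s, ∃ x ≠ 0, A x = μ • x := by
  by_contra! hcon
  have hbot : (⨆ μ ∈ s, eigenspace (A : E →ₗ[ℝ] E) μ) = ⊥ := by
    simp only [iSup_eq_bot, Submodule.eq_bot_iff]
    intro μ hμ x hx
    by_contra hx0
    exact hcon μ hμ x hx0 (Module.End.mem_eigenspace_iff.1 hx)
  rw [eigenvalueCount, hbot, rank_bot] at h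
  have : j ≤ 0 := by exact_mod_cast h
  omega

theorem abs_le_opNorm_of_apply_eq_smul {A : E →L[ℝ] E} {μ : ℝ} {x : E} (hx : x ≠ 0)
    (h : A x = μ • x) : |μ| ≤ ‖A‖ := by
  have := A.le_opNorm x
  rw [h, norm_smul] at this
  exact le_of_mul_le_mul_right this (norm_pos_iff.2 hx)

theorem ContinuousLinearMap.IsPositive.nonneg_of_apply_eq_smul {A : E →L[ℝ] E} (hA : A.IsPositive)
    {μ : ℝ} {x : E} (hx : x ≠ 0) (h : A x = μ • x) : 0 ≤ μ := by
  have := hA.inner_nonneg_left x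
  rw [h, inner_smul_left, real_inner_self_eq_norm_sq, RCLike.conj_to_real] at this
  exact nonneg_of_mul_nonneg_left this (by positivity)

theorem bddAbove_setOf_le_eigenvalueCount_Ici (A : E →L[ℝ] E) {j : ℕ} (hj : 1 ≤ j) :
    BddAbove {t : ℝ | (j : Cardinal) ≤ eigenvalueCount A (Set.Ici t)} := by
  refine ⟨‖A‖, fun t ht => ?_⟩
  obtain ⟨μ, hμ, x, hx, hAx⟩ := exists_eigenvector_of_le_eigenvalueCount hj ht
  exact (Set.mem_Ici.1 hμ).trans ((le_abs_self μ).trans (abs_le_opNorm_of_apply_eq_smul hx hAx))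

theorem ContinuousLinearMap.IsPositive.nonneg_of_le_eigenvalueCount_Iic {A : E →L[ℝ] E}
    (hA : A.IsPositive) {j : ℕ} (hj : 1 ≤ j) {t : ℝ}
    (ht : (j : Cardinal) ≤ eigenvalueCount A (Set.Iic t)) : 0 ≤ t := by
  obtain ⟨μ, hμ, x, hx, hAx⟩ := exists_eigenvector_of_le_eigenvalueCount hj ht
  exact (hA.nonneg_of_apply_eq_smul hx hAx).trans hμ

namespace IsDiagonalIn

variable {ι : Type*} {A : E →L[ℝ] E} {b : HilbertBasis ι ℝ E} {c : ι → ℝ} {s : Set ℝ}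

theorem mem_iSup_eigenspace (h : IsDiagonalIn A b c) {i : ι} (hi : c i ∈ s) :
    b i ∈ ⨆ μ ∈ s, eigenspace (A : E →ₗ[ℝ] E) μ :=
  Submodule.mem_iSup_of_mem (c i) (Submodule.mem_iSup_of_mem hi
    (Module.End.mem_eigenspace_iff.2 (h i)))

theorem inner_eq_zero_of_mem_orthogonal (h : IsDiagonalIn A b c) {x : E}
    (hx : x ∈ (⨆ μ ∈ s, eigenspace (A : E →ₗ[ℝ] E) μ)ᗮ) {i : ι} (hi : c i ∈ s) :
    ⟪b i, x⟫_ℝ = 0 :=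
  (Submodule.mem_orthogonal _ _).1 hx _ (h.mem_iSup_eigenspace hi)

theorem inner_eq_zero_of_mem_iSup (h : IsDiagonalIn A b c) {x : E}
    (hx : x ∈ ⨆ μ ∈ s, eigenspace (A : E →ₗ[ℝ] E) μ) {i : ι} (hi : c i ∉ s) :
    ⟪b i, x⟫_ℝ = 0 := by
  have hle : (⨆ μ ∈ s, eigenspace (A : E →ₗ[ℝ] E) μ) ≤ (Submodule.span ℝ {b i})ᗮ := by
    refine iSup₂_le fun μ hμ y hy => ?_
    rw [Submodule.mem_orthogonal_singleton_iff_inner_right]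
    have hy' : A y = μ • y := Module.End.mem_eigenspace_iff.1 hy
    have := h.inner_apply y i
    rw [hy', inner_smul_right] at this
    have hne : μ - c i ≠ 0 := sub_ne_zero.2 fun he => hi (he ▸ hμ)
    refine (mul_eq_zero.1 (?_ : (μ - c i) * ⟪b i, y⟫_ℝ = 0)).resolve_left hne
    linarith
  exact Submodule.mem_orthogonal_singleton_iff_inner_right.1 (hle hx)

/-- If all diagonal entries lie in `s`, then the eigenvalues in `s` exhaust the space, up to closure. -/
theorem le_eigenvalueCount (h : IsDiagonalIn A b c) (hs : ∀ i, c i ∈ s) {j : ℕ}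
    (hj : (j : Cardinal) ≤ Module.rank ℝ E) : (j : Cardinal) ≤ eigenvalueCount A s := by
  by_contra! hlt
  have hfin : Module.Finite ℝ ↥(⨆ μ ∈ s, eigenspace (A : E →ₗ[ℝ] E) μ) :=
    Module.rank_lt_aleph0_iff.1 (hlt.trans Cardinal.natCast_lt_aleph0)
  have htop : (⨆ μ ∈ s, eigenspace (A : E →ₗ[ℝ] E) μ) = ⊤ := by
    rw [eq_top_iff, ← b.dense_span]
    refine Submodule.topologicalClosure_minimal _ (Submodule.span_le.2 ?_)
      (Submodule.closed_of_finiteDimensional _)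
    rintro _ ⟨i, rfl⟩
    exact h.mem_iSup_eigenspace (hs i)
  rw [eigenvalueCount, htop, rank_top] at hlt
  exact absurd hj (not_le.2 hlt)

theorem inner_le (h : IsDiagonalIn A b c) {t : ℝ} {x : E}
    (hx : ∀ i, ⟪b i, x⟫_ℝ = 0 ∨ c i ≤ t) : ⟪A x, x⟫_ℝ ≤ t * ‖x‖ ^ 2 := by
  have h1 := ((one (b := b)).hasSum_norm_sq x).mul_left t
  refine hasSum_le (fun i => ?_) (h.hasSum_inner x) h1
  rcases hx i with h0 | h0
  · simp [h0]
  · simpa using mul_le_mul_of_nonneg_right h0 (sq_nonneg ⟪b i, x⟫_ℝ)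

theorem le_inner (h : IsDiagonalIn A b c) {t : ℝ} {x : E}
    (hx : ∀ i, ⟪b i, x⟫_ℝ = 0 ∨ t ≤ c i) : t * ‖x‖ ^ 2 ≤ ⟪A x, x⟫_ℝ := by
  have h1 := ((one (b := b)).hasSum_norm_sq x).mul_left t
  refine hasSum_le (fun i => ?_) h1 (h.hasSum_inner x)
  rcases hx i with h0 | h0
  · simp [h0]
  · simpa using mul_le_mul_of_nonneg_right h0 (sq_nonneg ⟪b i, x⟫_ℝ)

theorem norm_sq_le (h : IsDiagonalIn A b c) (hc : ∀ i, 0 ≤ c i) {t : ℝ} {x : E}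
    (hx : ∀ i, ⟪b i, x⟫_ℝ = 0 ∨ c i ≤ t) : ‖A x‖ ^ 2 ≤ t * ⟪A x, x⟫_ℝ := by
  refine hasSum_le (fun i => ?_) (h.hasSum_norm_sq x) ((h.hasSum_inner x).mul_left t)
  rcases hx i with h0 | h0
  · simp [h0]
  · rw [pow_two (c i), mul_assoc]
    exact mul_le_mul_of_nonneg_right h0 (mul_nonneg (hc i) (sq_nonneg _))

theorem le_norm_sq (h : IsDiagonalIn A b c) (hc : ∀ i, 0 ≤ c i) {t : ℝ} {x : E}
    (hx : ∀ i, ⟪b i, x⟫_ℝ = 0 ∨ t ≤ c i) : t * ⟪A x, x⟫_ℝ ≤ ‖A x‖ ^ 2 := by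
  refine hasSum_le (fun i => ?_) ((h.hasSum_inner x).mul_left t) (h.hasSum_norm_sq x)
  rcases hx i with h0 | h0
  · simp [h0]
  · rw [pow_two (c i), mul_assoc]
    exact mul_le_mul_of_nonneg_right h0 (mul_nonneg (hc i) (sq_nonneg _))

theorem inner_pos (h : IsDiagonalIn A b c) (hA : A.IsPositive) (hu : IsUnit A) {x : E}
    (hx : x ≠ 0) : 0 < ⟪A x, x⟫_ℝ := by
  obtain ⟨ε, hε, hle⟩ := h.exists_pos_le hA hu
  exact (by positivity : 0 < ε * ‖x‖ ^ 2).trans_le (h.le_inner fun i => Or.inr (hle i))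

end IsDiagonalIn

/-- If `J ^ 2 = -1` and `N' * J * N = J` with `N` invertible, then `N' = -J * N⁻¹ * J`, so that the
roles of `N` and `N'` can be exchanged. -/
theorem IsUnit.mul_mul_eq_of_mul_mul_eq {R : Type*} [Ring R] {N N' J : R} (hN : IsUnit N)
    (hJ : J * J = -1) (h : N' * J * N = J) : N * J * N' = J := by
  obtain ⟨u, rfl⟩ := hN
  have h1 : (-(J * N' * J)) * (u : R) = 1 := by
    calc (-(J * N' * J)) * (u : R) = -(J * (N' * J * u)) := by noncomm_ring
      _ = 1 := by rw [h, hJ, neg_neg]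
  have h2 : (u : R) * (-(J * N' * J)) = 1 := by
    rw [← Units.inv_eq_of_mul_eq_one_left h1, Units.mul_inv]
  calc (u : R) * J * N' = -(u * J * N' * (J * J)) := by rw [hJ]; noncomm_ring
    _ = (u * (-(J * N' * J))) * J := by noncomm_ring
    _ = J := by rw [h2, one_mul]

end

/-! ### The symplectic structure on `H ⊕ H` -/

section
variable {H : Type*} [NormedAddCommGroup H] [InnerProductSpace ℝ H]

@[simp] theorem sympJ_apply_fst (x : HilbertSum H) : (sympJ x).fst = x.snd := rfl
@[simp] theorem sympJ_apply_snd (x : HilbertSum H) : (sympJ x).snd = -x.fst := rfl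
@[simp] theorem doubled_apply_fst (D : H →L[ℝ] H) (x : HilbertSum H) :
    (doubled D x).fst = D x.fst := rfl
@[simp] theorem doubled_apply_snd (D : H →L[ℝ] H) (x : HilbertSum H) :
    (doubled D x).snd = D x.snd := rfl

theorem HilbertSum.ext {x y : HilbertSum H} (h1 : x.fst = y.fst) (h2 : x.snd = y.snd) : x = y :=
  WithLp.ofLp_injective 2 (Prod.ext h1 h2)

theorem HilbertSum.inner_eq (x y : HilbertSum H) :
    ⟪x, y⟫_ℝ = ⟪x.fst, y.fst⟫_ℝ + ⟪x.snd, y.snd⟫_ℝ := WithLp.prod_inner_apply x y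

theorem inner_sympJ_sympJ (x y : HilbertSum H) : ⟪sympJ x, sympJ y⟫_ℝ = ⟪x, y⟫_ℝ := by
  simp [add_comm]

theorem inner_sympJ_left (x y : HilbertSum H) : ⟪sympJ x, y⟫_ℝ = -⟪x, sympJ y⟫_ℝ := by
  simp only [HilbertSum.inner_eq, sympJ_apply_fst, sympJ_apply_snd, inner_neg_left,
    inner_neg_right]
  ring

theorem norm_sympJ (x : HilbertSum H) : ‖sympJ x‖ = ‖x‖ := by
  rw [norm_eq_sqrt_real_inner, norm_eq_sqrt_real_inner, inner_sympJ_sympJ]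

theorem sympJ_mul_sympJ : (sympJ : HilbertSum H →L[ℝ] HilbertSum H) * sympJ = -1 := by
  ext x
  · exact HilbertSum.ext (by simp) (by simp)

theorem sympJ_mul_doubled (D : H →L[ℝ] H) : sympJ * doubled D = doubled D * sympJ := by
  ext x
  · exact HilbertSum.ext (by simp) (by simp)

theorem doubled_mul (D D' : H →L[ℝ] H) : doubled (D * D') = doubled D * doubled D' := rfl

theorem doubled_one : doubled (1 : H →L[ℝ] H) = 1 := rfl

variable [CompleteSpace H]

theorem IsSymplecticTransformation.mul_sympJ_mul_star {M : HilbertSum H →L[ℝ] HilbertSum H}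
    (hM : IsSymplecticTransformation M) : M * sympJ * star M = sympJ :=
  hM.1.mul_mul_eq_of_mul_mul_eq sympJ_mul_sympJ hM.2

/-- The dimension count behind both inequalities. The conditions `T z ∈ Vᗮ` and `J (T z) ∈ Vᗮ` on
`u = M z` amount to fewer than `2 j` linear equations on `W × W`, which has dimension at least `2 j`. -/
theorem exists_mem_doubled_orthogonal {T M : HilbertSum H →L[ℝ] HilbertSum H} {D : H →L[ℝ] H}
    (hM : IsSymplecticTransformation M)
    (hT : T = ContinuousLinearMap.adjoint M ∘L doubled D ∘L M) {j : ℕ}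
    {W : Submodule ℝ H} {V : Submodule ℝ (HilbertSum H)}
    (hW : (j : Cardinal) ≤ Module.rank ℝ W) (hV : Module.rank ℝ V < j) :
    ∃ u z : HilbertSum H, u ≠ 0 ∧ u.fst ∈ W ∧ u.snd ∈ W ∧ T z ∈ Vᗮ ∧ sympJ (T z) ∈ Vᗮ ∧
      ⟪T z, z⟫_ℝ = ⟪doubled D u, u⟫_ℝ ∧
      ⟪T (sympJ (T z)), sympJ (T z)⟫_ℝ = ⟪doubled D (doubled D u), doubled D u⟫_ℝ := by
  have hfin : Module.Finite ℝ V :=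
    Module.rank_lt_aleph0_iff.1 (hV.trans Cardinal.natCast_lt_aleph0)
  have hTinner : ∀ x y, ⟪T x, y⟫_ℝ = ⟪doubled D (M x), M y⟫_ℝ := fun x y => by
    rw [hT]
    simp [ContinuousLinearMap.adjoint_inner_left]
  let incl : (W × W) →ₗ[ℝ] HilbertSum H :=
    (WithLp.linearEquiv 2 ℝ (H × H)).symm.toLinearMap ∘ₗ W.subtype.prodMap W.subtype
  let y : (W × W) →ₗ[ℝ] HilbertSum H :=
    ((ContinuousLinearMap.adjoint M ∘L doubled D : HilbertSum H →L[ℝ] HilbertSum H) :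
      HilbertSum H →ₗ[ℝ] HilbertSum H) ∘ₗ incl
  let P : HilbertSum H →ₗ[ℝ] V := (V.orthogonalProjectionOnto : HilbertSum H →L[ℝ] V)
  let J : HilbertSum H →ₗ[ℝ] HilbertSum H := (sympJ : HilbertSum H →L[ℝ] HilbertSum H)
  let Φ : (W × W) →ₗ[ℝ] (V × V) := (P ∘ₗ y).prod (P ∘ₗ J ∘ₗ y)
  have hnot : ¬ Function.Injective Φ := by
    intro hinj
    have hle := LinearMap.rank_le_of_injective Φ hinj
    rw [rank_prod', rank_prod', ← Module.finrank_eq_rank ℝ V] at hle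
    rw [← Module.finrank_eq_rank ℝ V] at hV
    have h2 : ((j + j : ℕ) : Cardinal) ≤
        ((Module.finrank ℝ V + Module.finrank ℝ V : ℕ) : Cardinal) := by
      push_cast
      exact (add_le_add hW hW).trans hle
    have h3 : j + j ≤ Module.finrank ℝ V + Module.finrank ℝ V := by exact_mod_cast h2
    have h4 : Module.finrank ℝ V < j := by exact_mod_cast hV
    omega
  rw [injective_iff_map_eq_zero] at hnot
  push Not at hnot
  obtain ⟨p, hp, hp0⟩ := hnot
  have hp1 : P (y p) = 0 := congrArg Prod.fst hp
  have hp2 : P (J (y p)) = 0 := congrArg Prod.snd hp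
  have hbij : Function.Surjective M := by
    obtain ⟨⟨u, rfl⟩, -⟩ := hM
    intro x
    exact ⟨((u⁻¹ : (HilbertSum H →L[ℝ] HilbertSum H)ˣ) : HilbertSum H →L[ℝ] HilbertSum H) x, by
      rw [← mul_apply_eq_comp, Units.mul_inv]; rfl⟩
  obtain ⟨z, hz⟩ := hbij (incl p)
  have hTz : T z = y p := by rw [hT]; simp [y, hz]
  refine ⟨incl p, z, ?_, p.1.2, p.2.2, ?_, ?_, ?_, ?_⟩
  · intro h0
    refine hp0 (Prod.ext (Subtype.ext ?_) (Subtype.ext ?_))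
    · exact congrArg WithLp.fst h0
    · exact congrArg WithLp.snd h0
  · rw [hTz]
    exact Submodule.orthogonalProjectionOnto_eq_zero_iff.1 hp1
  · rw [hTz]
    exact Submodule.orthogonalProjectionOnto_eq_zero_iff.1 hp2
  · rw [hTinner, hz]
  · have hMJ : M (sympJ (T z)) = sympJ (doubled D (incl p)) := by
      rw [hTz]
      exact congrArg (fun f : HilbertSum H →L[ℝ] HilbertSum H => f (doubled D (incl p)))
        hM.mul_sympJ_mul_star
    have hcomm : ∀ x, doubled D (sympJ x) = sympJ (doubled D x) := fun x =>
      congrArg (fun f : HilbertSum H →L[ℝ] HilbertSum H => f x) (sympJ_mul_doubled D).symm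
    rw [hTinner, hMJ, hcomm, inner_sympJ_sympJ]

end

/-! ### Eigenvectors of a Williamson normal form -/

section
variable {E : Type*} [NormedAddCommGroup E] [InnerProductSpace ℝ E]

theorem IsCompactOperator.mul_mul {K : E →L[ℝ] E} (hK : IsCompactOperator K) (A B : E →L[ℝ] E) :
    IsCompactOperator (A * K * B) :=
  (hK.clm_comp A).comp_clm B

/-- Eigenvectors of the square of a positive operator are eigenvectors of the operator. -/
theorem ContinuousLinearMap.IsPositive.apply_eq_sqrt_smul {A : E →L[ℝ] E} (hA : A.IsPositive)
    {ν : ℝ} {x : E} (h : A (A x) = ν • x) : A x = √ν • x := by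
  have hnorm : ‖A x‖ ^ 2 = ν * ‖x‖ ^ 2 := by
    rw [← real_inner_self_eq_norm_sq, ← hA.inner_left_eq_inner_right, h, inner_smul_left,
      real_inner_self_eq_norm_sq, RCLike.conj_to_real]
  rcases le_or_gt ν 0 with hν | hν
  · have h0 : ‖A x‖ ^ 2 ≤ 0 := by
      rw [hnorm]
      exact mul_nonpos_of_nonpos_of_nonneg hν (sq_nonneg _)
    rw [Real.sqrt_eq_zero_of_nonpos hν, zero_smul]
    simpa using le_antisymm h0 (sq_nonneg _)
  · -- `A x - √ν • x` is an eigenvector of `A` for `-√ν < 0`, so it vanishes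
    set y := A x - √ν • x with hy
    have hAy : A y = (-√ν) • y := by
      rw [hy, map_sub, map_smul, h, smul_sub, smul_smul, neg_mul, Real.mul_self_sqrt hν.le,
        neg_smul, neg_smul]
      abel
    by_contra hne
    have hy0 : y ≠ 0 := sub_ne_zero.2 hne
    have := hA.nonneg_of_apply_eq_smul hy0 hAy
    have := Real.sqrt_pos.2 hν
    linarith

theorem ContinuousLinearMap.IsPositive.orthogonal_iSup_eigenspace_eq_bot_of_mul_self
    {A : E →L[ℝ] E} (hA : A.IsPositive)
    (h : (⨆ μ, eigenspace ((A * A : E →L[ℝ] E) : E →ₗ[ℝ] E) μ)ᗮ = ⊥) :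
    (⨆ μ, eigenspace (A : E →ₗ[ℝ] E) μ)ᗮ = ⊥ := by
  rw [eq_bot_iff, ← h]
  refine Submodule.orthogonal_le (iSup_le fun ν x hx => ?_)
  exact Submodule.mem_iSup_of_mem (√ν) (Module.End.mem_eigenspace_iff.2
    (hA.apply_eq_sqrt_smul (Module.End.mem_eigenspace_iff.1 hx)))

end

section
variable {H : Type*} [NormedAddCommGroup H] [InnerProductSpace ℝ H]
  {T : HilbertSum H →L[ℝ] HilbertSum H} {D : H →L[ℝ] H}

/-- If `M` conjugates `J T` into `J S`, with `J` a complex structure commuting with `S`, and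
`T = K + a` with `a` a scalar, then `S ^ 2 - a ^ 2` lies in the two-sided ideal generated by `K`. -/
theorem mul_self_sub_mul_self_eq {R : Type*} [Ring R] {J T K a M N S : R} (hJ : J * J = -1)
    (hMN : M * N = 1) (hT : T = K + a) (haJ : a * J = J * a) (haM : a * M = M * a)
    (hconj : M * (J * T) = J * S * M) (hJS : J * S = S * J) :
    S * S - a * a = M * (a * K * 1 - J * K * (J * T)) * N := by
  have h1 : M * (J * T * (J * T)) * N = -(S * S) := by
    calc M * (J * T * (J * T)) * N = M * (J * T) * (J * T) * N := by simp only [mul_assoc]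
      _ = J * S * (M * (J * T)) * N := by rw [← mul_assoc (J * S), ← hconj]
      _ = J * S * (J * S) * (M * N) := by rw [hconj]; simp only [mul_assoc]
      _ = J * (S * J) * S := by rw [hMN, mul_one]; simp only [mul_assoc]
      _ = (J * J) * (S * S) := by rw [← hJS]; simp only [mul_assoc]
      _ = -(S * S) := by rw [hJ, neg_one_mul]
  have h2 : J * T * (J * T) = J * K * (J * T) - a * K - a * a := by
    calc J * T * (J * T) = J * (K + a) * (J * T) := by rw [← hT]
      _ = J * K * (J * T) + (J * a) * J * T := by noncomm_ring
      _ = J * K * (J * T) + a * (J * J) * T := by rw [← haJ]; simp only [mul_assoc]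
      _ = J * K * (J * T) - a * (K + a) := by rw [hJ, ← hT]; noncomm_ring
      _ = _ := by noncomm_ring
  have h3 : M * (a * a) * N = a * a := by
    calc M * (a * a) * N = (M * a) * a * N := by simp only [mul_assoc]
      _ = a * a * (M * N) := by rw [← haM, mul_assoc a M a, ← haM]; simp only [mul_assoc]
      _ = a * a := by rw [hMN, mul_one]
  calc S * S - a * a = -(M * (J * T * (J * T)) * N) - M * (a * a) * N := by
        rw [h1, h3, neg_neg]
    _ = _ := by rw [h2]; noncomm_ring

theorem isCompactOperator_of_doubled {A : H →L[ℝ] H} (h : IsCompactOperator (doubled A)) :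
    IsCompactOperator A := by
  let e := WithLp.prodContinuousLinearEquiv 2 ℝ H H
  exact (h.clm_comp (ContinuousLinearMap.fst ℝ H H ∘L e.toContinuousLinearMap)).comp_clm
    (e.symm.toContinuousLinearMap ∘L ContinuousLinearMap.inl ℝ H H)

theorem rank_hilbertSum_ge {j : ℕ} (hj : (j : Cardinal) ≤ Module.rank ℝ H) :
    (j : Cardinal) ≤ Module.rank ℝ (HilbertSum H) := by
  rw [(WithLp.linearEquiv 2 ℝ (H × H)).rank_eq, rank_prod']
  exact hj.trans (self_le_add_right _ _)

theorem IsDiagonalIn.doubled_inner_pos {κ : Type*} {e : HilbertBasis κ ℝ H} {d : κ → ℝ}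
    (hDd : IsDiagonalIn D e d) (hpos : D.IsPositive) (hu : IsUnit D) {x : HilbertSum H}
    (hx : x ≠ 0) : 0 < ⟪doubled D x, x⟫_ℝ := by
  rw [HilbertSum.inner_eq, doubled_apply_fst, doubled_apply_snd]
  by_cases h1 : x.fst = 0
  · have h2 : x.snd ≠ 0 := fun h2 => hx (HilbertSum.ext h1 h2)
    exact add_pos_of_nonneg_of_pos (hpos.inner_nonneg_left _) (hDd.inner_pos hpos hu h2)
  · exact add_pos_of_pos_of_nonneg (hDd.inner_pos hpos hu h1) (hpos.inner_nonneg_left _)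

variable [CompleteSpace H]

/-- The square of a Williamson normal form of `T` differs from `α ^ 2` by a compact operator. -/
theorem IsWilliamsonForm.isCompactOperator_mul_self_sub (hD : IsWilliamsonForm T D) {α : ℝ}
    (hcomp : IsCompactOperator (T - α • ContinuousLinearMap.id ℝ (HilbertSum H))) :
    IsCompactOperator (D * D - α ^ 2 • ContinuousLinearMap.id ℝ H) := by
  obtain ⟨-, -, M, hM, hTM⟩ := hD
  obtain ⟨u, hu⟩ := hM.1
  set N : HilbertSum H →L[ℝ] HilbertSum H := 
    ((u⁻¹ : (HilbertSum H →L[ℝ] HilbertSum H)ˣ) : HilbertSum H →L[ℝ] HilbertSum H)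
  have hMN : M * N = 1 := by rw [← hu]; exact u.mul_inv
  set J : HilbertSum H →L[ℝ] HilbertSum H := sympJ
  have hJJ : J * J = -1 := sympJ_mul_sympJ
  have hconj : M * (J * T) = J * doubled D * M := by
    calc M * (J * T) = (M * J * star M) * (doubled D * M) := by
          rw [hTM, ← ContinuousLinearMap.star_eq_adjoint]; simp only [mul_assoc]; rfl
      _ = J * doubled D * M := by rw [hM.mul_sympJ_mul_star, mul_assoc]
  set K := T - α • ContinuousLinearMap.id ℝ (HilbertSum H) with hK
  set a : HilbertSum H →L[ℝ] HilbertSum H := α • ContinuousLinearMap.id ℝ (HilbertSum H) with ha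
  have hTK : T = K + a := (sub_add_cancel _ _).symm
  have haJ : a * J = J * a := by ext x; simp [ha]
  have haM : a * M = M * a := by ext x; simp [ha]
  have hDD : doubled D * doubled D - a * a = M * (a * K * 1 - J * K * (J * T)) * N :=
    mul_self_sub_mul_self_eq hJJ hMN hTK haJ haM hconj (sympJ_mul_doubled D)
  apply isCompactOperator_of_doubled
  have hfinal : doubled (D * D - α ^ 2 • ContinuousLinearMap.id ℝ H)
      = M * (a * K * 1 - J * K * (J * T)) * N := by
    rw [← hDD]
    ext x
    exact HilbertSum.ext (by simp [ha, smul_smul, pow_two]) (by simp [ha, smul_smul, pow_two])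
  rw [hfinal]
  exact IsCompactOperator.mul_mul (K := a * K * 1 - J * K * (J * T))
    ((hcomp.mul_mul a 1).sub (hcomp.mul_mul J (J * T))) M N

theorem IsWilliamsonForm.exists_isDiagonalIn (hD : IsWilliamsonForm T D) {α : ℝ}
    (hcomp : IsCompactOperator (T - α • ContinuousLinearMap.id ℝ (HilbertSum H))) :
    ∃ (S : Set H) (b : HilbertBasis S ℝ H) (c : S → ℝ), IsDiagonalIn D b c := by
  have hsymm := hD.1.isSymmetric
  refine _root_.exists_isDiagonalIn hsymm
    (hD.1.orthogonal_iSup_eigenspace_eq_bot_of_mul_self ?_)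
  refine orthogonal_iSup_eigenspace_eq_bot (fun x y => ?_) (hD.isCompactOperator_mul_self_sub hcomp)
  exact (hsymm (D x) y).trans (hsymm x (D y))

/-! ### The eigenvalue inequalities -/

variable {ι κ : Type*} {b : HilbertBasis ι ℝ (HilbertSum H)} {c : ι → ℝ}
  {e : HilbertBasis κ ℝ H} {d : κ → ℝ} {j : ℕ}

/-- If `D` has at least `j` eigenvalues `≥ t`, then so many eigenvalues of `T` are `≥ s`, for every
`s < t`. -/
theorem le_eigenvalueCount_Ici_of_lt (hD : IsWilliamsonForm T D) (hpos : T.IsPositive)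
    (hinv : IsUnit T) (hTc : IsDiagonalIn T b c) (hDd : IsDiagonalIn D e d) {s t : ℝ}
    (hs : 0 ≤ s) (hst : s < t) (ht : (j : Cardinal) ≤ eigenvalueCount D (Set.Ici t)) :
    (j : Cardinal) ≤ eigenvalueCount T (Set.Ici s) := by
  by_contra! hlt
  obtain ⟨hDpos, hDu, M, hM, hTM⟩ := hD
  obtain ⟨u, z, hu, hu1, hu2, hy, hJy, hTz, hTJ⟩ := exists_mem_doubled_orthogonal hM hTM ht hlt
  have hd0 := hDd.nonneg hDpos
  obtain ⟨ε, hε, hcε⟩ := hTc.exists_pos_le hpos hinv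
  -- `T z ⊥ V` gives `z ⊥ V`, as `T` is diagonal with nonzero entries
  have hT1 : ‖T z‖ ^ 2 ≤ s * ⟪T z, z⟫_ℝ := by
    refine hTc.norm_sq_le (hTc.nonneg hpos) fun i => ?_
    by_cases hi : c i ∈ Set.Ici s
    · have := hTc.inner_eq_zero_of_mem_orthogonal hy hi
      rw [hTc.inner_apply] at this
      exact Or.inl ((mul_eq_zero.1 this).resolve_left (hε.trans_le (hcε i)).ne')
    · exact Or.inr (not_le.1 hi).le
  have hT2 : ⟪T (sympJ (T z)), sympJ (T z)⟫_ℝ ≤ s * ‖T z‖ ^ 2 := by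
    rw [← norm_sympJ (T z)]
    refine hTc.inner_le fun i => ?_
    by_cases hi : c i ∈ Set.Ici s
    · exact Or.inl (hTc.inner_eq_zero_of_mem_orthogonal hJy hi)
    · exact Or.inr (not_le.1 hi).le
  have hmain : ∀ w ∈ ⨆ μ ∈ Set.Ici t, eigenspace (D : H →ₗ[ℝ] H) μ,
      t * (t * ⟪D w, w⟫_ℝ) ≤ ⟪D (D w), D w⟫_ℝ := fun w hw => by
    have hw' : ∀ i, ⟪e i, w⟫_ℝ = 0 ∨ t ≤ d i := fun i => by
      by_cases hi : d i ∈ Set.Ici t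
      · exact Or.inr hi
      · exact Or.inl (hDd.inner_eq_zero_of_mem_iSup hw hi)
    have h1 := hDd.le_norm_sq hd0 hw'
    have h2 := hDd.le_inner (x := D w) (t := t) fun i =>
      (hw' i).imp_left fun h => by rw [hDd.inner_apply, h, mul_zero]
    exact (mul_le_mul_of_nonneg_left h1 (hs.trans hst.le)).trans h2
  have hD1 : t * (t * ⟪doubled D u, u⟫_ℝ) ≤ ⟪doubled D (doubled D u), doubled D u⟫_ℝ := by
    have := add_le_add (hmain _ hu1) (hmain _ hu2)
    simp only [HilbertSum.inner_eq, doubled_apply_fst, doubled_apply_snd]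
    linarith
  have hup := hDd.doubled_inner_pos hDpos hDu hu
  rw [hTJ] at hT2
  rw [hTz] at hT1
  have h3 : t * (t * ⟪doubled D u, u⟫_ℝ) ≤ s * (s * ⟪doubled D u, u⟫_ℝ) :=
    hD1.trans (hT2.trans (mul_le_mul_of_nonneg_left hT1 hs))
  have h4 : s * s < t * t := mul_self_lt_mul_self hs hst
  exact absurd h3 (not_le.2 (by simpa only [mul_assoc] using mul_lt_mul_of_pos_right h4 hup))

/-- If `D` has at least `j` eigenvalues `≤ t`, then so many eigenvalues of `T` are `≤ s`, for every
`s > t`. -/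
theorem le_eigenvalueCount_Iic_of_lt (hD : IsWilliamsonForm T D) (hpos : T.IsPositive)
    (hinv : IsUnit T) (hTc : IsDiagonalIn T b c) (hDd : IsDiagonalIn D e d) {s t : ℝ}
    (ht0 : 0 ≤ t) (hst : t < s) (ht : (j : Cardinal) ≤ eigenvalueCount D (Set.Iic t)) :
    (j : Cardinal) ≤ eigenvalueCount T (Set.Iic s) := by
  by_contra! hlt
  obtain ⟨hDpos, hDu, M, hM, hTM⟩ := hD
  obtain ⟨u, z, hu, hu1, hu2, hy, hJy, hTz, hTJ⟩ := exists_mem_doubled_orthogonal hM hTM ht hlt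
  have hd0 := hDd.nonneg hDpos
  obtain ⟨ε, hε, hcε⟩ := hTc.exists_pos_le hpos hinv
  -- `T z ⊥ V` gives `z ⊥ V`, as `T` is diagonal with nonzero entries
  have hT1 : s * ⟪T z, z⟫_ℝ ≤ ‖T z‖ ^ 2 := by
    refine hTc.le_norm_sq (hTc.nonneg hpos) fun i => ?_
    by_cases hi : c i ∈ Set.Iic s
    · have := hTc.inner_eq_zero_of_mem_orthogonal hy hi
      rw [hTc.inner_apply] at this
      exact Or.inl ((mul_eq_zero.1 this).resolve_left (hε.trans_le (hcε i)).ne')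
    · exact Or.inr (not_le.1 hi).le
  have hT2 : s * ‖T z‖ ^ 2 ≤ ⟪T (sympJ (T z)), sympJ (T z)⟫_ℝ := by
    rw [← norm_sympJ (T z)]
    refine hTc.le_inner fun i => ?_
    by_cases hi : c i ∈ Set.Iic s
    · exact Or.inl (hTc.inner_eq_zero_of_mem_orthogonal hJy hi)
    · exact Or.inr (not_le.1 hi).le
  have hmain : ∀ w ∈ ⨆ μ ∈ Set.Iic t, eigenspace (D : H →ₗ[ℝ] H) μ,
      ⟪D (D w), D w⟫_ℝ ≤ t * (t * ⟪D w, w⟫_ℝ) := fun w hw => by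
    have hw' : ∀ i, ⟪e i, w⟫_ℝ = 0 ∨ d i ≤ t := fun i => by
      by_cases hi : d i ∈ Set.Iic t
      · exact Or.inr hi
      · exact Or.inl (hDd.inner_eq_zero_of_mem_iSup hw hi)
    have h1 := hDd.norm_sq_le hd0 hw'
    have h2 := hDd.inner_le (x := D w) (t := t) fun i =>
      (hw' i).imp_left fun h => by rw [hDd.inner_apply, h, mul_zero]
    exact h2.trans (mul_le_mul_of_nonneg_left h1 ht0)
  have hD1 : ⟪doubled D (doubled D u), doubled D u⟫_ℝ ≤ t * (t * ⟪doubled D u, u⟫_ℝ) := by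
    have := add_le_add (hmain _ hu1) (hmain _ hu2)
    simp only [HilbertSum.inner_eq, doubled_apply_fst, doubled_apply_snd]
    linarith
  have hup := hDd.doubled_inner_pos hDpos hDu hu
  rw [hTJ] at hT2
  rw [hTz] at hT1
  have h3 : s * (s * ⟪doubled D u, u⟫_ℝ) ≤ t * (t * ⟪doubled D u, u⟫_ℝ) :=
    (mul_le_mul_of_nonneg_left hT1 (ht0.trans hst.le)).trans (hT2.trans hD1)
  have h4 : t * t < s * s := mul_self_lt_mul_self ht0 hst
  exact absurd h3 (not_le.2 (by simpa only [mul_assoc] using mul_lt_mul_of_pos_right h4 hup))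

theorem eigenvalueDecr_le_of_isWilliamsonForm (hD : IsWilliamsonForm T D) (hpos : T.IsPositive)
    (hinv : IsUnit T) (hTc : IsDiagonalIn T b c) (hDd : IsDiagonalIn D e d) (hj : 1 ≤ j)
    (hjH : (j : Cardinal) ≤ Module.rank ℝ H) : eigenvalueDecr D j ≤ eigenvalueDecr T j := by
  have hbdd := bddAbove_setOf_le_eigenvalueCount_Ici T hj
  have h0 : 0 ≤ eigenvalueDecr T j :=
    le_csSup hbdd (hTc.le_eigenvalueCount (fun i => hTc.nonneg hpos i) (rank_hilbertSum_ge hjH))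
  -- no eigenvalue count of `D` is needed here: an empty supremum would be `0`, which `h0` covers
  refine Real.sSup_le (fun t ht => ?_) h0
  refine le_of_forall_lt fun s hs => ?_
  obtain ⟨r, hsr, hrt⟩ := exists_between hs
  rcases le_or_gt 0 r with hr | hr
  · exact hsr.trans_le (le_csSup hbdd
      (le_eigenvalueCount_Ici_of_lt hD hpos hinv hTc hDd hr hrt ht))
  · exact hsr.trans (hr.trans_le h0)

theorem eigenvalueIncr_le_of_isWilliamsonForm (hD : IsWilliamsonForm T D) (hpos : T.IsPositive)
    (hinv : IsUnit T) (hTc : IsDiagonalIn T b c) (hDd : IsDiagonalIn D e d) (hj : 1 ≤ j)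
    (hjH : (j : Cardinal) ≤ Module.rank ℝ H) : eigenvalueIncr T j ≤ eigenvalueIncr D j := by
  have hbdd : BddBelow {t : ℝ | (j : Cardinal) ≤ eigenvalueCount T (Set.Iic t)} :=
    ⟨0, fun t ht => hpos.nonneg_of_le_eigenvalueCount_Iic hj ht⟩
  -- all eigenvalues of `D` are at most `‖D‖`, and there are at least `j` of them
  have hne : {t : ℝ | (j : Cardinal) ≤ eigenvalueCount D (Set.Iic t)}.Nonempty :=
    ⟨‖D‖, hDd.le_eigenvalueCount
      (fun i => Set.mem_Iic.2 ((le_abs_self _).trans (hDd.abs_le_norm i))) hjH⟩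
  refine le_csInf hne fun t ht => ?_
  have ht0 : 0 ≤ t := hD.1.nonneg_of_le_eigenvalueCount_Iic hj ht
  refine le_of_forall_gt fun s hs => ?_
  obtain ⟨r, htr, hrs⟩ := exists_between hs
  have hr : (j : Cardinal) ≤ eigenvalueCount T (Set.Iic r) :=
    le_eigenvalueCount_Iic_of_lt hD hpos hinv hTc hDd ht0 htr ht
  exact (csInf_le hbdd hr).trans_lt hrs

end

/-! ### Cardinality of Hilbert bases and square roots -/

section
variable {E : Type*} [NormedAddCommGroup E] [InnerProductSpace ℝ E]

theorem Orthonormal.countable_of_separableSpace [TopologicalSpace.SeparableSpace E] {ι : Type*}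
    {v : ι → E} (hv : Orthonormal ℝ v) : Countable ι := by
  obtain ⟨s, hs, hd⟩ := TopologicalSpace.exists_countable_dense E
  have := hs.to_subtype
  choose f hfs hf using fun i => hd.exists_dist_lt (v i) (ε := 1 / 2) (by norm_num)
  refine Function.Injective.countable (f := fun i => (⟨f i, hfs i⟩ : s)) fun i k hik => ?_
  -- distinct orthonormal vectors have distance `√2 > 1`
  by_contra hne
  have hik' : f i = f k := congrArg Subtype.val hik
  have h1 : ‖v i - v k‖ < 1 := by
    rw [← dist_eq_norm]
    calc dist (v i) (v k) ≤ dist (v i) (f i) + dist (v k) (f i) := dist_triangle_right _ _ _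
      _ < 1 := by
        have h1 := hf i
        have h2 := hf k
        rw [← hik'] at h2
        linarith
  have h2 : ‖v i - v k‖ ^ 2 = 2 := by
    rw [norm_sub_sq_real, hv.1, hv.1, hv.2 hne]
    norm_num
  nlinarith [norm_nonneg (v i - v k)]

namespace HilbertBasis

variable {ι κ : Type*}

theorem exists_reindex [CompleteSpace E] (b : HilbertBasis ι ℝ E) (σ : κ ≃ ι) :
    ∃ b' : HilbertBasis κ ℝ E, ∀ k, b' k = b (σ k) := by
  refine ⟨HilbertBasis.mk (b.orthonormal.comp σ σ.injective) ?_, fun k => ?_⟩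
  · rw [Set.range_comp, σ.surjective.range_eq, Set.image_univ, b.dense_span]
  · rw [HilbertBasis.coe_mk]; rfl

theorem finiteDimensional_iff (b : HilbertBasis ι ℝ E) : FiniteDimensional ℝ E ↔ Finite ι := by
  refine ⟨fun h => b.orthonormal.linearIndependent.finite, fun h => ?_⟩
  have := Fintype.ofFinite ι
  exact b.toOrthonormalBasis.toBasis.finiteDimensional_of_finite

/-- Any two Hilbert bases of a separable space are indexed by equipotent sets. -/
theorem nonempty_equiv [TopologicalSpace.SeparableSpace E] (b : HilbertBasis ι ℝ E)
    (b' : HilbertBasis κ ℝ E) : Nonempty (ι ≃ κ) := by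
  have hiff : Finite ι ↔ Finite κ := b.finiteDimensional_iff.symm.trans b'.finiteDimensional_iff
  rcases finite_or_infinite ι with h | h
  · have h' := hiff.1 h
    have := Fintype.ofFinite ι
    have := Fintype.ofFinite κ
    refine ⟨Fintype.equivOfCardEq ?_⟩
    rw [← Module.finrank_eq_card_basis b.toOrthonormalBasis.toBasis,
      ← Module.finrank_eq_card_basis b'.toOrthonormalBasis.toBasis]
  · have h' : Infinite κ := by rwa [← not_finite_iff_infinite, ← hiff, not_finite_iff_infinite]
    have := b.orthonormal.countable_of_separableSpace
    have := b'.orthonormal.countable_of_separableSpace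
    exact nonempty_equiv_of_countable

theorem eq_zero_of_inner_eq_zero (b : HilbertBasis ι ℝ E) {x : E} (h : ∀ i, ⟪b i, x⟫_ℝ = 0) :
    x = 0 := by
  have := (IsDiagonalIn.one (b := b)).hasSum_norm_sq x
  simp only [h] at this
  simpa using this.tsum_eq.symm

/-- The diagonal operators with entries `c` and `c⁻¹`, for `c` bounded and bounded away from zero. -/
theorem exists_diagonal_inverse (b : HilbertBasis ι ℝ E) {c : ι → ℝ} {ε C : ℝ} (hε : 0 < ε)
    (hc : ∀ i, ε ≤ c i) (hC : ∀ i, c i ≤ C) :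
    ∃ A A' : E →L[ℝ] E, IsDiagonalIn A b c ∧ IsDiagonalIn A' b c⁻¹ ∧ A * A' = 1 ∧ A' * A = 1 := by
  have hpos : ∀ i, 0 < c i := fun i => hε.trans_le (hc i)
  obtain ⟨A, hA⟩ := b.exists_diagonal c (C := C) fun i => by rw [abs_of_pos (hpos i)]; exact hC i
  obtain ⟨A', hA'⟩ := b.exists_diagonal c⁻¹ (C := ε⁻¹) fun i => by
    rw [Pi.inv_apply, abs_of_pos (inv_pos.2 (hpos i))]
    exact inv_anti₀ hε (hc i)
  have hA : IsDiagonalIn A b c := hA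
  have hA' : IsDiagonalIn A' b c⁻¹ := hA'
  have hcc : c * c⁻¹ = 1 := funext fun i => mul_inv_cancel₀ (hpos i).ne'
  have hcc' : c⁻¹ * c = 1 := (mul_comm _ _).trans hcc
  exact ⟨A, A', hA, hA', (hcc ▸ hA.mul hA').eq IsDiagonalIn.one,
    (hcc' ▸ hA'.mul hA).eq IsDiagonalIn.one⟩

end HilbertBasis

/-- A diagonal positive invertible operator has a symmetric invertible square root. (The continuous
functional calculus is not available for operators on a real Hilbert space.) -/
theorem IsDiagonalIn.exists_sqrt {ι : Type*} {A : E →L[ℝ] E} {b : HilbertBasis ι ℝ E} {c : ι → ℝ}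
    (h : IsDiagonalIn A b c) (hA : A.IsPositive) (hu : IsUnit A) :
    ∃ R : E →L[ℝ] E, (R : E →ₗ[ℝ] E).IsSymmetric ∧ IsUnit R ∧ R * R = A := by
  obtain ⟨ε, hε, hle⟩ := h.exists_pos_le hA hu
  obtain ⟨R, R', hR, -, h1, h2⟩ := b.exists_diagonal_inverse (c := fun i => √(c i)) (ε := √ε)
    (C := √‖A‖) (Real.sqrt_pos.2 hε) (fun i => Real.sqrt_le_sqrt (hle i))
    (fun i => Real.sqrt_le_sqrt ((le_abs_self _).trans (h.abs_le_norm i)))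
  refine ⟨R, hR.isSymmetric, ⟨⟨R, R', h1, h2⟩, rfl⟩, ?_⟩
  have hcc : (fun i => √(c i)) * (fun i => √(c i)) = c :=
    funext fun i => Real.mul_self_sqrt (h.nonneg hA i)
  exact (hcc ▸ hR.mul hR).eq h

/-! ### Identities for the normal form -/

theorem isUnit_of_mul_self_eq_neg_one {A : Type*} [Ring A] {J : A} (hJ : J * J = -1) : IsUnit J :=
  ⟨⟨J, -J, by rw [mul_neg, hJ, neg_neg], by rw [neg_mul, hJ, neg_neg]⟩, rfl⟩

/-- If `R ^ 2 = K + a` with `a` a scalar and `J ^ 2 = -1`, then `-(R J R) ^ 2 - a ^ 2` lies in the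
two-sided ideal generated by `K`. -/
theorem neg_mul_self_sub_mul_self_eq {A : Type*} [Ring A] {R J K a : A} (hJ : J * J = -1)
    (hR : R * R = K + a) (haJ : a * J = J * a) (haR : a * R = R * a) :
    -((R * J * R) * (R * J * R)) - a * a = a * K * 1 - (R * J) * K * (J * R) := by
  have h1 : (R * J) * a * (J * R) = -(a * (K + a)) := by
    calc (R * J) * a * (J * R) = R * a * (J * J) * R := by
          rw [mul_assoc R J a, ← haJ]; simp only [mul_assoc]
      _ = -(a * (R * R)) := by rw [hJ, ← haR]; noncomm_ring
      _ = _ := by rw [hR]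
  calc -((R * J * R) * (R * J * R)) - a * a = -((R * J) * (R * R) * (J * R)) - a * a := by
        simp only [mul_assoc]
    _ = -((R * J) * K * (J * R)) - (R * J) * a * (J * R) - a * a := by rw [hR]; noncomm_ring
    _ = _ := by rw [h1]; noncomm_ring

/-- If `Q` conjugates `R J R` into `J S` and `G ^ 2 = S⁻¹`, then `M = G Q R` satisfies `Mᵀ J M = J`.
Here `Q'` is the inverse and transpose of `Q`, while `R` and `G` are their own transposes. -/
theorem IsUnit.mul_mul_eq_of_mul_eq {A : Type*} [Ring A] {R J S Q Q' G : A} (hR : IsUnit R)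
    (hJ : J * J = -1) (hQ : Q' * Q = 1) (hQ' : Q * Q' = 1) (hG : S * (G * G) = 1)
    (hJS : J * S = S * J) (hJG : J * G = G * J) (h : Q * (R * J * R) = J * S * Q) :
    (R * Q' * G) * J * (G * Q * R) = J := by
  set Y := Q' * J * (G * G) * Q with hY
  have hM : (R * Q' * G) * J * (G * Q * R) = R * Y * R := by
    calc (R * Q' * G) * J * (G * Q * R) = R * (Q' * (G * J) * G * Q) * R := by
          simp only [mul_assoc]
      _ = R * Y * R := by rw [← hJG, hY]; simp only [mul_assoc]
  have h1 : (R * J * R) * Y = -1 := by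
    calc (R * J * R) * Y = (Q' * Q) * (R * J * R) * Y := by rw [hQ, one_mul]
      _ = Q' * (J * S * Q) * Y := by rw [← h]; simp only [mul_assoc]
      _ = Q' * J * S * (Q * Q') * J * (G * G) * Q := by rw [hY]; simp only [mul_assoc]
      _ = Q' * J * (S * J) * (G * G) * Q := by rw [hQ']; simp only [mul_one, mul_assoc]
      _ = Q' * (J * J) * (S * (G * G)) * Q := by rw [← hJS]; simp only [mul_assoc]
      _ = -1 := by rw [hJ, hG]; simp [hQ]
  have h2 : J * (R * Y * R) = -1 := by
    refine hR.mul_left_cancel ?_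
    calc R * (J * (R * Y * R)) = (R * J * R) * Y * R := by simp only [mul_assoc]
      _ = R * -1 := by rw [h1]; simp
  calc (R * Q' * G) * J * (G * Q * R) = -(J * J) * (R * Y * R) := by rw [hM, hJ]; simp
    _ = -(J * (J * (R * Y * R))) := by rw [neg_mul, mul_assoc]
    _ = J := by rw [h2]; simp

end

/-! ### Hilbert bases of `H ⊕ H` -/

section
variable {H : Type*} [NormedAddCommGroup H] [InnerProductSpace ℝ H]

/-- The Hilbert basis of `H ⊕ H` given by two copies of a Hilbert basis of `H`. The left index is put
in the second summand, so that `J` maps the left half of the basis to the right half. -/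
theorem HilbertBasis.exists_hilbertSum [CompleteSpace H] {κ : Type*} (e : HilbertBasis κ ℝ H) :
    ∃ g : HilbertBasis (κ ⊕ κ) ℝ (HilbertSum H),
      (∀ k, g (Sum.inl k) = WithLp.toLp 2 (0, e k)) ∧
      ∀ k, g (Sum.inr k) = WithLp.toLp 2 (e k, 0) := by
  classical
  let g : κ ⊕ κ → HilbertSum H :=
    Sum.elim (fun k => WithLp.toLp 2 (0, e k)) fun k => WithLp.toLp 2 (e k, 0)
  have he := orthonormal_iff_ite.1 e.orthonormal
  have hg : Orthonormal ℝ g := by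
    rw [orthonormal_iff_ite]
    rintro (i | i) (k | k) <;> simp [g, he]
  have hbot : (Submodule.span ℝ (Set.range g))ᗮ = ⊥ := by
    rw [Submodule.eq_bot_iff]
    intro x hx
    have hx' : ∀ i, ⟪g i, x⟫_ℝ = 0 := fun i =>
      (Submodule.mem_orthogonal _ _).1 hx _ (Submodule.subset_span ⟨i, rfl⟩)
    refine HilbertSum.ext (e.eq_zero_of_inner_eq_zero fun k => ?_)
      (e.eq_zero_of_inner_eq_zero fun k => ?_)
    · simpa [g] using hx' (Sum.inr k)
    · simpa [g] using hx' (Sum.inl k)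
  refine ⟨HilbertBasis.mkOfOrthogonalEqBot hg hbot, fun k => ?_, fun k => ?_⟩ <;>
  rw [HilbertBasis.coe_mkOfOrthogonalEqBot] <;> rfl

theorem nonempty_equiv_of_hilbertBasis_sum [CompleteSpace H] [TopologicalSpace.SeparableSpace H]
    {ι κ : Type*} (b : HilbertBasis (ι ⊕ ι) ℝ (HilbertSum H)) (e : HilbertBasis κ ℝ H) :
    Nonempty (ι ≃ κ) := by
  obtain ⟨g, -, -⟩ := e.exists_hilbertSum
  have : TopologicalSpace.SeparableSpace (HilbertSum H) :=
    (WithLp.prodContinuousLinearEquiv 2 ℝ H H).symm.surjective.denseRange.separableSpace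
      (WithLp.prodContinuousLinearEquiv 2 ℝ H H).symm.continuous
  obtain ⟨σ⟩ := b.nonempty_equiv g
  have hiff : Finite ι ↔ Finite κ := by
    constructor <;> intro
    · have := Finite.of_equiv _ σ
      exact Finite.sum_left κ
    · have := Finite.of_equiv _ σ.symm
      exact Finite.sum_left ι
  rcases finite_or_infinite ι with h | h
  · have h' := hiff.1 h
    have := Fintype.ofFinite ι
    have := Fintype.ofFinite κ
    have hcard := Fintype.card_congr σ
    rw [Fintype.card_sum, Fintype.card_sum] at hcard
    exact ⟨Fintype.equivOfCardEq (by omega)⟩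
  · have h' : Infinite κ := by rwa [← not_finite_iff_infinite, ← hiff, not_finite_iff_infinite]
    have := b.orthonormal.countable_of_separableSpace
    have := g.orthonormal.countable_of_separableSpace
    have : Countable ι := (Sum.inl_injective (α := ι) (β := ι)).countable
    have : Countable κ := (Sum.inl_injective (α := κ) (β := κ)).countable
    exact nonempty_equiv_of_countable

end

/-! ### Existence of the normal form -/

section
variable {E : Type*} [NormedAddCommGroup E] [InnerProductSpace ℝ E] [CompleteSpace E]

/-- Normal form of an invertible skew operator whose square is a compact perturbation of a scalar:
in a suitable Hilbert basis it is a direct sum of blocks `[[0, -c], [c, 0]]` with `c` bounded away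
from zero. -/
theorem exists_hilbertBasis_of_skew {B : E →L[ℝ] E} (hB : ∀ x y, ⟪B x, y⟫_ℝ = -⟪x, B y⟫_ℝ)
    (hu : IsUnit B) {β : ℝ}
    (hcomp : IsCompactOperator (-(B * B) - β • ContinuousLinearMap.id ℝ E)) :
    ∃ (S : Set E) (f : HilbertBasis (S ⊕ S) ℝ E) (c : S → ℝ) (ε : ℝ), 0 < ε ∧ (∀ v, ε ≤ c v) ∧
      (∀ v, c v ≤ ‖B‖) ∧ (∀ v, B (f (Sum.inl v)) = c v • f (Sum.inr v)) ∧
      ∀ v, B (f (Sum.inr v)) = -(c v • f (Sum.inl v)) := by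
  classical
  have hC : ((-(B * B) : E →L[ℝ] E) : E →ₗ[ℝ] E).IsSymmetric := by
    intro x y
    have h1 := hB (B x) y
    have h2 := hB x (B y)
    simp only [ContinuousLinearMap.coe_coe, neg_apply, mul_apply_eq_comp, inner_neg_left,
      inner_neg_right]
    linarith
  obtain ⟨S, hon, hev, hiso, hbot⟩ := exists_maximal_isotropic_eigenvectors (C := -(B * B)) (B := B)
    hC (orthogonal_iSup_eigenspace_eq_bot hC hcomp) hB (fun x => by simp)
  -- the eigenvalue of `-B ^ 2` at the unit vector `v` is `‖B v‖ ^ 2`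
  have hBB : ∀ v : S, B (B v) = -(‖B v‖ ^ 2 • (v : E)) := by
    intro v
    obtain ⟨μ, hμ⟩ := hev v v.2
    have hμ' : B (B v) = -(μ • (v : E)) := by rw [← hμ]; simp
    have h1 := hB v (B v)
    rw [hμ', inner_neg_right, inner_smul_right, real_inner_self_eq_norm_sq,
      real_inner_self_eq_norm_sq, hon.1 v] at h1
    rw [hμ', h1]
    simp
  obtain ⟨ε, hε, hlow⟩ : ∃ ε > 0, ∀ v : S, ε ≤ ‖B v‖ := by
    obtain ⟨u, rfl⟩ := hu
    set N : E →L[ℝ] E := ((u⁻¹ : (E →L[ℝ] E)ˣ) : E →L[ℝ] E)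
    refine ⟨(‖N‖ + 1)⁻¹, by positivity, fun v => ?_⟩
    have h1 : N ((u : E →L[ℝ] E) v) = v := by
      rw [← mul_apply_eq_comp, Units.inv_mul]; rfl
    have h2 := N.le_opNorm ((u : E →L[ℝ] E) v)
    rw [h1, hon.1 v] at h2
    rw [inv_le_iff_one_le_mul₀ (by positivity)]
    nlinarith [norm_nonneg ((u : E →L[ℝ] E) v)]
  have hne : ∀ v : S, ‖B v‖ ≠ 0 := fun v => (hε.trans_le (hlow v)).ne'
  let f : S ⊕ S → E := Sum.elim (fun v => (v : E)) fun v => ‖B v‖⁻¹ • B v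
  have hite := orthonormal_iff_ite.1 hon
  have hf : Orthonormal ℝ f := by
    rw [orthonormal_iff_ite]
    rintro (v | v) (w | w)
    · simpa [f] using hite v w
    · simp [f, inner_smul_right, hiso v v.2 w w.2]
    · have := hB v w
      rw [hiso v v.2 w w.2, neg_zero] at this
      simp [f, inner_smul_left, this]
    · have h1 : ⟪B v, B w⟫_ℝ = ‖B w‖ ^ 2 * ⟪(v : E), w⟫_ℝ := by
        rw [hB, hBB, inner_neg_right, neg_neg, inner_smul_right]
      simp only [f, Sum.elim_inr, inner_smul_left, inner_smul_right, RCLike.conj_to_real, h1,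
        hite v w, Sum.inr.injEq]
      split_ifs with hvw
      · subst hvw
        have := hne v
        field_simp
      · simp
  have hspan : (Submodule.span ℝ (Set.range f))ᗮ = ⊥ := by
    rw [eq_bot_iff, ← hbot]
    refine Submodule.orthogonal_le (Submodule.span_le.2 ?_)
    rintro x (hx | ⟨y, hy, rfl⟩)
    · exact Submodule.subset_span ⟨Sum.inl ⟨x, hx⟩, rfl⟩
    · have : B y = ‖B y‖ • f (Sum.inr ⟨y, hy⟩) := by
        simp [f, smul_smul, mul_inv_cancel₀ (hne ⟨y, hy⟩)]
      rw [SetLike.mem_coe, this]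
      exact Submodule.smul_mem _ _ (Submodule.subset_span ⟨_, rfl⟩)
  refine ⟨S, HilbertBasis.mkOfOrthogonalEqBot hf hspan, fun v => ‖B v‖, ε, hε, hlow, fun v => ?_,
    fun v => ?_, fun v => ?_⟩
  · simpa [hon.1 v] using B.le_opNorm v
  · simp [HilbertBasis.coe_mkOfOrthogonalEqBot, f, smul_smul, mul_inv_cancel₀ (hne v)]
  · rw [HilbertBasis.coe_mkOfOrthogonalEqBot]
    simp only [f, Sum.elim_inl, Sum.elim_inr, map_smul, hBB, smul_neg, smul_smul]
    congr 2
    have := hne v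
    field_simp

end

section
variable {H : Type*} [NormedAddCommGroup H] [InnerProductSpace ℝ H] [CompleteSpace H]

/-- Existence of a Williamson normal form. -/
theorem exists_isWilliamsonForm [TopologicalSpace.SeparableSpace H]
    {T : HilbertSum H →L[ℝ] HilbertSum H} (hpos : T.IsPositive) (hinv : IsUnit T) {ι : Type*}
    {b : HilbertBasis ι ℝ (HilbertSum H)} {c : ι → ℝ} (hTc : IsDiagonalIn T b c) {α : ℝ}
    (hcomp : IsCompactOperator (T - α • ContinuousLinearMap.id ℝ (HilbertSum H))) :
    ∃ D : H →L[ℝ] H, IsWilliamsonForm T D := by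
  obtain ⟨R, hRs, hRu, hRR⟩ := hTc.exists_sqrt hpos hinv
  set J : HilbertSum H →L[ℝ] HilbertSum H := sympJ
  have hJJ : J * J = -1 := sympJ_mul_sympJ
  have hJu : IsUnit J := isUnit_of_mul_self_eq_neg_one hJJ
  have hB : ∀ x y, ⟪(R * J * R) x, y⟫_ℝ = -⟪x, (R * J * R) y⟫_ℝ := fun x y => by
    calc ⟪R (J (R x)), y⟫_ℝ = ⟪J (R x), R y⟫_ℝ := hRs _ _
      _ = -⟪R x, J (R y)⟫_ℝ := inner_sympJ_left _ _
      _ = -⟪x, R (J (R y))⟫_ℝ := congrArg Neg.neg (hRs _ _)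
  have hBcomp : IsCompactOperator
      (-((R * J * R) * (R * J * R)) - α ^ 2 • ContinuousLinearMap.id ℝ (HilbertSum H)) := by
    set K := T - α • ContinuousLinearMap.id ℝ (HilbertSum H) with hK
    set a : HilbertSum H →L[ℝ] HilbertSum H := α • ContinuousLinearMap.id ℝ (HilbertSum H) with ha
    have haa : α ^ 2 • ContinuousLinearMap.id ℝ (HilbertSum H) = a * a := by
      ext x; simp [ha, smul_smul, pow_two]
    have hTK : T = K + a := (sub_add_cancel _ _).symm
    have haJ : a * J = J * a := by ext x; simp [ha]
    have haR : a * R = R * a := by ext x; simp [ha]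
    have h1 : -((R * J * R) * (R * J * R)) - a * a = a * K * 1 - (R * J) * K * (J * R) :=
      neg_mul_self_sub_mul_self_eq hJJ (hRR.trans hTK) haJ haR
    rw [haa, h1]
    exact (hcomp.mul_mul a 1).sub (hcomp.mul_mul (R * J) (J * R))
  obtain ⟨S, f, d, ε, hε, hlow, hup, hf1, hf2⟩ :=
    exists_hilbertBasis_of_skew hB ((hRu.mul hJu).mul hRu) hBcomp
  obtain ⟨w, e₀, -⟩ := exists_hilbertBasis ℝ H
  obtain ⟨σ⟩ := nonempty_equiv_of_hilbertBasis_sum f e₀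
  obtain ⟨e, -⟩ := e₀.exists_reindex σ
  obtain ⟨g, hg1, hg2⟩ := e.exists_hilbertSum
  obtain ⟨D, D', hD, -, hDD', hD'D⟩ := e.exists_diagonal_inverse hε hlow hup
  obtain ⟨F, G, -, hG, hFG, hGF⟩ := e.exists_diagonal_inverse (c := fun v => √(d v)) (ε := √ε)
    (C := √‖R * J * R‖) (Real.sqrt_pos.2 hε) (fun v => Real.sqrt_le_sqrt (hlow v))
    (fun v => Real.sqrt_le_sqrt (hup v))
  -- `G` is the operator `D ^ (-1 / 2)`
  have hd0 : ∀ v, 0 < d v := fun v => hε.trans_le (hlow v)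
  have hDGG : D * (G * G) = 1 := by
    have hc : d * ((fun v => √(d v))⁻¹ * (fun v => √(d v))⁻¹) = 1 := funext fun v => by
      have h1 := Real.mul_self_sqrt (hd0 v).le
      simp only [Pi.mul_apply, Pi.inv_apply, Pi.one_apply]
      rw [← mul_inv, h1, mul_inv_cancel₀ (hd0 v).ne']
    exact (hc ▸ hD.mul (hG.mul hG)).eq IsDiagonalIn.one
  have hGDG : G * D * G = 1 := by
    have hc : (fun v => √(d v))⁻¹ * d * (fun v => √(d v))⁻¹ = 1 := funext fun v => by
      have h1 := Real.mul_self_sqrt (hd0 v).le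
      simp only [Pi.mul_apply, Pi.inv_apply, Pi.one_apply]
      rw [mul_right_comm, ← mul_inv, h1, inv_mul_cancel₀ (hd0 v).ne']
    exact (hc ▸ (hG.mul hD).mul hG).eq IsDiagonalIn.one
  let q : HilbertSum H ≃ₗᵢ[ℝ] HilbertSum H := f.repr.trans g.repr.symm
  let Q : HilbertSum H →L[ℝ] HilbertSum H := q.toContinuousLinearEquiv
  let Q' : HilbertSum H →L[ℝ] HilbertSum H := q.symm.toContinuousLinearEquiv
  have hQQ' : Q * Q' = 1 := by ext x; simp [Q, Q']
  have hQ'Q : Q' * Q = 1 := by ext x; simp [Q, Q']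
  have hQf : ∀ i, Q (f i) = g i := fun i => by
    classical
    simp [Q, q, f.repr_self]
  have hQB : Q * (R * J * R) = J * doubled D * Q := by
    refine f.clm_ext ?_
    rintro (v | v)
    · calc Q ((R * J * R) (f (Sum.inl v))) = d v • g (Sum.inr v) := by rw [hf1, map_smul, hQf]
        _ = J (doubled D (Q (f (Sum.inl v)))) := by
          rw [hQf, hg1, hg2]
          exact HilbertSum.ext (by simp [J, hD v]) (by simp [J])
    · calc Q ((R * J * R) (f (Sum.inr v))) = -(d v • g (Sum.inl v)) := by
            rw [hf2, map_neg, map_smul, hQf]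
        _ = J (doubled D (Q (f (Sum.inr v)))) := by
          rw [hQf, hg1, hg2]
          exact HilbertSum.ext (by simp [J]) (by simp [J, hD v])
  have hQstar : star Q = Q' := LinearIsometryEquiv.adjoint_eq_symm q
  have hRstar : star R = R := (ContinuousLinearMap.isSelfAdjoint_iff_isSymmetric.2 hRs)
  have hGstar : star (doubled G) = doubled G := by
    refine ContinuousLinearMap.isSelfAdjoint_iff_isSymmetric.2 fun x y => ?_
    have h1 : ∀ x y : H, ⟪G x, y⟫_ℝ = ⟪x, G y⟫_ℝ := hG.isSymmetric
    simp [h1]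
  have hMstar : star (doubled G * Q * R) = R * Q' * doubled G := by
    rw [star_mul, star_mul, hQstar, hRstar, hGstar, mul_assoc]
  have hGu : IsUnit (doubled G) :=
    ⟨⟨doubled G, doubled F, by rw [← doubled_mul, hGF, doubled_one],
      by rw [← doubled_mul, hFG, doubled_one]⟩, rfl⟩
  have hQu : IsUnit Q := ⟨⟨Q, Q', hQQ', hQ'Q⟩, rfl⟩
  refine ⟨D, hD.isPositive fun v => (hd0 v).le, ⟨⟨D, D', hDD', hD'D⟩, rfl⟩,
    doubled G * Q * R, ⟨(hGu.mul hQu).mul hRu, ?_⟩, ?_⟩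
  · change star (doubled G * Q * R) * (J * (doubled G * Q * R)) = J
    rw [hMstar, ← mul_assoc]
    refine hRu.mul_mul_eq_of_mul_eq hJJ hQ'Q hQQ' ?_ (sympJ_mul_doubled D) (sympJ_mul_doubled G) hQB
    rw [← doubled_mul, ← doubled_mul, hDGG, doubled_one]
  · change T = star (doubled G * Q * R) * (doubled D * (doubled G * Q * R))
    have hG1 : doubled G * doubled D * doubled G = 1 := by
      rw [← doubled_mul, ← doubled_mul, hGDG, doubled_one]
    calc T = R * (Q' * (doubled G * doubled D * doubled G) * Q) * R := by
          rw [hG1, mul_one, hQ'Q, mul_one, hRR]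
      _ = _ := by rw [hMstar]; simp only [mul_assoc]

end

/-- The symplectic eigenvalues of `T` are the eigenvalues of any of its Williamson normal forms
`D`; one exists, and the inequalities hold for each. If `H` has finite dimension `n`, the index
`j` runs through `1, …, n`; otherwise through all positive integers. -/
theorem theorem2p1 {H : Type*} [NormedAddCommGroup H] [InnerProductSpace ℝ H] [CompleteSpace H]
    [TopologicalSpace.SeparableSpace H]
    (T : HilbertSum H →L[ℝ] HilbertSum H) (hpos : T.IsPositive) (hinv : IsUnit T)
    (α : ℝ) (hα : α ≠ 0)
    (hcomp : IsCompactOperator (T - α • ContinuousLinearMap.id ℝ (HilbertSum H))) :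
    (∃ D : H →L[ℝ] H, IsWilliamsonForm T D) ∧
    ∀ D : H →L[ℝ] H, IsWilliamsonForm T D →
      ∀ j : ℕ, 1 ≤ j → (j : Cardinal) ≤ Module.rank ℝ H →
        eigenvalueDecr D j ≤ eigenvalueDecr T j ∧
        eigenvalueIncr T j ≤ eigenvalueIncr D j := by
  obtain ⟨S, b, c, hTc⟩ := exists_isDiagonalIn hpos.isSymmetric
    (orthogonal_iSup_eigenspace_eq_bot hpos.isSymmetric hcomp)
  refine ⟨exists_isWilliamsonForm hpos hinv hTc hcomp, fun D hD j hj hjH => ?_⟩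
  obtain ⟨S', e, d, hDd⟩ := hD.exists_isDiagonalIn hcomp
  exact ⟨eigenvalueDecr_le_of_isWilliamsonForm hD hpos hinv hTc hDd hj hjH,
    eigenvalueIncr_le_of_isWilliamsonForm hD hpos hinv hTc hDd hj hjH⟩
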